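/- Let $\varphi:\mathbb{R}^2\to\mathbb{R}$ and $\psi:\mathbb{R}\to\mathbb{R}$ be $C^1$ and satisfy the Levinson–Smith conditions $C_{LS}$: $x\psi(x)>0$ for $x\neq0$; $\int_0^x\psi(s)\,ds\to+\infty$ as $x\to+\infty$; $\varphi(0,0)<0$; and there are $0<x_0<x_1$ and $M>0$ such that $\varphi(x,y)\ge0$ for $|x|\ge x_0$, $\varphi(x,y)\ge-M$ for $|x|\le x_0$, and $\int_{x_0}^{x_1}\varphi(x,y(x))\,dx\ge10Mx_0$ for every decreasing function $y(x)>0$. Let $\omega:\mathbb{R}^3\to\mathbb{R}$, $(s,x,y)\mapsto\omega(s,x,y)$, be $C^1$ and $1$-periodic in $s$. Let $u_0$ be a nonconstant periodic solution, with least positive period $\tau_0$, of $$u''+\varphi(u,u')u'+\psi(u)=0,$$ equivalently of the plane system $x'=f(x)$, $x=(x_1,x_2)=(u',u)$, $f(x)=(-\varphi(x_2,x_1)x_1-\psi(x_2),\,x_1)$. Suppose that $1$ is a simple characteristic multiplier of the variational system $y'=f'(u_0'(t),u_0(t))\,y$, that is, an eigenvalue of algebraic multiplicity one of $\Phi(\tau_0)$,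 where $\Phi$ is the fundamental matrix of that system with $\Phi(0)=I$. Then there is $t_0$ with $u_0(t_0)<0$ and $u_0'(t_0)=0$. Moreover, for every such $t_0$, with $a=u_0(t_0)$, there are an open set $U\subset\mathbb{R}^2$ containing $(0,0)$, $C^1$ functions $\tau,h:U\to\mathbb{R}$ with $\tau(0,0)=\tau_0$ and $h(0,0)=0$, and a constant $0<\tau_1<\tau_0$, such that for every $(\varepsilon,\alpha)\in U$ one has $|\tau(\varepsilon,\alpha)-\tau_0|<\tau_1$ and the solution $u$ of $$u''+\varphi(u,u')u'+\psi(u)=\varepsilon\,\omega\Big(\frac{t}{\tau(\varepsilon,\alpha)},u,u'\Big),\qquad u(\alpha)=a+h(\varepsilon,\alpha),\quad u'(\alpha)=0,$$ exists on all of $\mathbb{R}$ and is periodic with period $\tau(\varepsilon,\alpha)$. -/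

import Mathlib

open Set Filter Topology

/-- The Levinson–Smith conditions on `φ : ℝ² → ℝ` and `ψ : ℝ → ℝ`. -/
structure LevinsonSmith (φ : ℝ × ℝ → ℝ) (ψ : ℝ → ℝ) : Prop where
  sign : ∀ x : ℝ, 0 < |x| → 0 < x * ψ x
  primitive : Tendsto (fun x : ℝ => ∫ s in (0 : ℝ)..x, ψ s) atTop atTop
  origin : φ (0, 0) < 0
  bounds : ∃ x₀ x₁ M : ℝ, 0 < x₀ ∧ x₀ < x₁ ∧ 0 < M ∧
    (∀ x y : ℝ, x₀ ≤ |x| → 0 ≤ φ (x, y)) ∧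
    (∀ x y : ℝ, |x| ≤ x₀ → -M ≤ φ (x, y)) ∧
    (∀ y : ℝ → ℝ, StrictAntiOn y (Icc x₀ x₁) → (∀ x ∈ Icc x₀ x₁, 0 < y x) →
      10 * M * x₀ ≤ ∫ x in x₀..x₁, φ (x, y x))

/-- `u` is a solution, on all of `ℝ`, of `u'' + φ(u, u') u' + ψ(u) = F(t, u, u')`. -/
def IsLienardSolution (φ : ℝ × ℝ → ℝ) (ψ : ℝ → ℝ) (F : ℝ → ℝ → ℝ → ℝ) (u : ℝ → ℝ) : Prop :=
  Differentiable ℝ u ∧ Differentiable ℝ (deriv u) ∧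
    ∀ t : ℝ, deriv (deriv u) t + φ (u t, deriv u t) * deriv u t + ψ (u t) = F t (u t) (deriv u t)

/-- The vector field of the plane system equivalent to `u'' + φ(u, u') u' + ψ(u) = 0`,
in the coordinates `x = (u', u)`. -/
def lienardField (φ : ℝ × ℝ → ℝ) (ψ : ℝ → ℝ) (x : Fin 2 → ℝ) : Fin 2 → ℝ :=
  ![-(φ (x 1, x 0)) * x 0 - ψ (x 1), x 0]

/-- The coefficient matrix `f'(q(t))` of the variational system `y' = f'(q(t)) y` along
`q = (u', u)`. -/
noncomputable def variationalMatrix (φ : ℝ × ℝ → ℝ) (ψ : ℝ → ℝ) (u : ℝ → ℝ) (t : ℝ) :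
    Matrix (Fin 2) (Fin 2) ℝ :=
  LinearMap.toMatrix' (fderiv ℝ (lienardField φ ψ) ![deriv u t, u t] : (Fin 2 → ℝ) →ₗ[ℝ] (Fin 2 → ℝ))

/-- `Φ` is the fundamental matrix of `y' = A(t) y` with `Φ(0) = I`. -/
def IsFundamentalMatrix (A Φ : ℝ → Matrix (Fin 2) (Fin 2) ℝ) : Prop :=
  Φ 0 = 1 ∧ ∀ (t : ℝ) (i j : Fin 2), HasDerivAt (fun s => Φ s i j) ((A t * Φ t) i j) t

/-- `μ` is a simple characteristic multiplier of the `T`-periodic system `y' = A(t) y`: an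
eigenvalue of algebraic multiplicity one of the fundamental matrix at time `T`. -/
def IsSimpleMultiplier (A : ℝ → Matrix (Fin 2) (Fin 2) ℝ) (T μ : ℝ) : Prop :=
  ∃ Φ : ℝ → Matrix (Fin 2) (Fin 2) ℝ,
    IsFundamentalMatrix A Φ ∧ (Φ T).charpoly.rootMultiplicity μ = 1

/-! With `s = (t - α) / τ` the problem becomes: find a `1`-periodic `x` with `x' = τ g(ε, s + α / τ,
x)` and `x 0 = c + h e`, where `c = (0, a)` and `e = (0, 1)`. The trajectory itself is kept as an
unknown in `C([0, 1], E)`, so the integral equation together with `x 1 = x 0` is one equation for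
`(τ, h, x)`. It is `C¹` because superposition operators are, and no differentiable dependence of a
flow on parameters is needed. The implicit function theorem then gives `τ` and `h`.

At `ε = 0` the linearization has a Volterra part `1 - V`, which is always invertible
(`isUnit_one_sub_volterra`). Eliminating the trajectory leaves the plane map `(τ, h) ↦ τ f(q 0) + h
(y T - e)`, with `y` the variational solution starting at `e`. At a turning point with `a < 0` the
velocity `f(q 0) = (-ψ a, 0)` is independent of `e`. If the plane map were singular, the period map
would be a shear along `f(q 0)` and `1` would be a double multiplier
(`exists_transversal_solution`). -/

/-! ### Superposition operators on spaces of continuous functions. -/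

section ContinuousMapCalculus

variable {K E F : Type*} [TopologicalSpace K] [CompactSpace K]
  [NormedAddCommGroup E] [NormedSpace ℝ E] [NormedAddCommGroup F] [NormedSpace ℝ F]

/-- Pointwise application of an operator-valued continuous function, as a continuous bilinear map. -/
noncomputable def pointwiseApply (K E F : Type*) [TopologicalSpace K] [CompactSpace K]
    [NormedAddCommGroup E] [NormedSpace ℝ E] [NormedAddCommGroup F] [NormedSpace ℝ F] :
    C(K, E →L[ℝ] F) →L[ℝ] C(K, E) →L[ℝ] C(K, F) :=
  LinearMap.mkContinuous₂
    (LinearMap.mk₂ ℝ (fun (A : C(K, E →L[ℝ] F)) (y : C(K, E)) =>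
        (⟨fun s => A s (y s), A.continuous.clm_apply y.continuous⟩ : C(K, F)))
      (fun _ _ _ => by ext; simp) (fun _ _ _ => by ext; simp)
      (fun _ _ _ => by ext; simp) (fun _ _ _ => by ext; simp)) 1 (by
    intro A y
    rw [one_mul, ContinuousMap.norm_le _ (by positivity)]
    intro s
    exact ((A s).le_opNorm _).trans (mul_le_mul (A.norm_coe_le_norm s) (y.norm_coe_le_norm s)
      (norm_nonneg _) (norm_nonneg A)))

@[simp]
theorem pointwiseApply_apply (A : C(K, E →L[ℝ] F)) (y : C(K, E)) (s : K) :
    pointwiseApply K E F A y s = A s (y s) := rfl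

/-- `E` need not be locally compact, but the range of `x` is compact, so `g'` is continuous there
with one `δ` for all `s`; the mean value inequality on balls of radius `δ` does the rest. -/
theorem hasFDerivAt_comp_left {g : C(E, F)} {g' : C(E, E →L[ℝ] F)}
    (hg : ∀ x, HasFDerivAt g (g' x) x) (x : C(K, E)) :
    HasFDerivAt (fun y : C(K, E) => g.comp y) (pointwiseApply K E F (g'.comp x)) x := by
  refine .of_isLittleO (Asymptotics.isLittleO_iff.2 fun c hc => ?_)
  have hu := (isCompact_range x.continuous).uniformContinuousAt_of_continuousAt g'
    (fun a _ => g'.continuous.continuousAt) (Metric.dist_mem_uniformity hc)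
  obtain ⟨δ, hδ, hδu⟩ := Metric.mem_uniformity_dist.1 hu
  filter_upwards [Metric.ball_mem_nhds x hδ] with y hy
  rw [ContinuousMap.norm_le _ (by positivity)]
  intro s
  have hys : y s ∈ Metric.ball (x s) δ := (ContinuousMap.dist_apply_le_dist s).trans_lt hy
  have := (convex_ball (x s) δ).norm_image_sub_le_of_norm_hasFDerivWithin_le'
    (f := g) (f' := g') (φ := g' (x s)) (C := c) (fun z _ => (hg z).hasFDerivWithinAt)
    (fun z hz => by
      have h1 := hδu (a := x s) (b := z) (by rwa [dist_comm]) (mem_range_self s)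
      rw [← dist_eq_norm, dist_comm]
      exact le_of_lt h1)
    (Metric.mem_ball_self hδ) hys
  calc _ = ‖g (y s) - g (x s) - g' (x s) (y s - x s)‖ := rfl
    _ ≤ c * ‖y s - x s‖ := this
    _ ≤ c * ‖y - x‖ := by gcongr; exact (y - x).norm_coe_le_norm s

/-- The superposition operator of a `C¹` map is `C¹` on continuous functions. -/
theorem contDiff_comp_left {g : C(E, F)} (hg : ContDiff ℝ 1 g) :
    ContDiff ℝ 1 (fun y : C(K, E) => g.comp y) := by
  let g' : C(E, E →L[ℝ] F) := ⟨fderiv ℝ g, hg.continuous_fderiv one_ne_zero⟩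
  have hg' : ∀ x, HasFDerivAt g (g' x) x := fun x =>
    (hg.differentiable one_ne_zero x).hasFDerivAt
  refine contDiff_one_iff_hasFDerivAt.2 ⟨fun x => pointwiseApply K E F (g'.comp x), ?_,
    hasFDerivAt_comp_left hg'⟩
  exact (pointwiseApply K E F).continuous.comp (ContinuousMap.continuous_postcomp g')

end ContinuousMapCalculus

/-! ### Volterra operators on `C([0, 1], E)`. -/

section Volterra

variable {E F : Type*} [NormedAddCommGroup E] [NormedSpace ℝ E]
  [NormedAddCommGroup F] [NormedSpace ℝ F]

theorem norm_integral_IccExtend_le (x : C(Icc (0 : ℝ) 1, E)) (s : Icc (0 : ℝ) 1) :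
    ‖∫ r in (0 : ℝ)..s, IccExtend zero_le_one x r‖ ≤ ‖x‖ := by
  have h := intervalIntegral.norm_integral_le_of_norm_le_const (a := 0) (b := (s : ℝ)) (C := ‖x‖)
    (f := IccExtend zero_le_one x) (fun r _ => x.norm_coe_le_norm _)
  refine h.trans (mul_le_of_le_one_right (norm_nonneg _) ?_)
  rw [sub_zero, abs_of_nonneg s.2.1]
  exact s.2.2

/-- The primitive vanishing at `0`, as an operator on `C([0, 1], E)`. -/
noncomputable def primitiveCLM (E : Type*) [NormedAddCommGroup E] [NormedSpace ℝ E] :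
    C(Icc (0 : ℝ) 1, E) →L[ℝ] C(Icc (0 : ℝ) 1, E) :=
  LinearMap.mkContinuous
    { toFun := fun x => ⟨fun s => ∫ r in (0 : ℝ)..s, IccExtend zero_le_one x r,
        (intervalIntegral.continuous_primitive
          (fun _ _ => (x.continuous.Icc_extend' (h := zero_le_one)).intervalIntegrable _ _) 0).comp
          continuous_subtype_val⟩
      map_add' := fun x y => by
        ext s
        exact intervalIntegral.integral_add
          ((x.continuous.Icc_extend' (h := zero_le_one)).intervalIntegrable _ _)
          ((y.continuous.Icc_extend' (h := zero_le_one)).intervalIntegrable _ _)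
      map_smul' := fun c x => by
        ext s
        exact intervalIntegral.integral_smul c (IccExtend zero_le_one x) }
    1 (by
      intro x
      rw [one_mul, ContinuousMap.norm_le _ (norm_nonneg _)]
      exact norm_integral_IccExtend_le x)

theorem primitiveCLM_apply (x : C(Icc (0 : ℝ) 1, E)) (s : Icc (0 : ℝ) 1) :
    primitiveCLM E x s = ∫ r in (0 : ℝ)..s, IccExtend zero_le_one x r := rfl

@[simp]
theorem primitiveCLM_apply_zero (x : C(Icc (0 : ℝ) 1, E)) : primitiveCLM E x 0 = 0 := by
  simp [primitiveCLM_apply]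

/-- The fundamental theorem of calculus for `primitiveCLM`. -/
theorem primitiveCLM_eq_of_hasDerivAt [CompleteSpace E] {Y : ℝ → E} {y : C(Icc (0 : ℝ) 1, E)}
    (hY : ∀ s : Icc (0 : ℝ) 1, HasDerivAt Y (y s) s) (s : Icc (0 : ℝ) 1) :
    primitiveCLM E y s = Y s - Y 0 := by
  rw [primitiveCLM_apply]
  refine intervalIntegral.integral_eq_sub_of_hasDerivAt (fun r hr => ?_)
    ((y.continuous.Icc_extend' (h := zero_le_one)).intervalIntegrable _ _)
  rw [uIcc_of_le s.2.1] at hr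
  have hr' : r ∈ Icc (0 : ℝ) 1 := ⟨hr.1, hr.2.trans s.2.2⟩
  rw [IccExtend_of_mem _ _ hr']
  exact hY ⟨r, hr'⟩

/-- The Volterra operator `y ↦ ∫₀ A y`. -/
noncomputable def volterra (A : C(Icc (0 : ℝ) 1, E →L[ℝ] E)) :
    C(Icc (0 : ℝ) 1, E) →L[ℝ] C(Icc (0 : ℝ) 1, E) :=
  primitiveCLM E ∘L pointwiseApply _ E E A

/-- Each integration raises the power of `s` and supplies the next factor of the factorial, so some
iterate is a contraction whatever the size of `A`. -/
theorem norm_volterra_pow_apply_le (A : C(Icc (0 : ℝ) 1, E →L[ℝ] E)) (y : C(Icc (0 : ℝ) 1, E))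
    (n : ℕ) (s : Icc (0 : ℝ) 1) :
    ‖(volterra A ^ n) y s‖ ≤ ‖A‖ ^ n * ‖y‖ * ((s : ℝ) ^ n / n.factorial) := by
  induction n generalizing s with
  | zero => simpa using y.norm_coe_le_norm s
  | succ n ih =>
    rw [pow_succ']
    change ‖∫ r in (0 : ℝ)..s, IccExtend zero_le_one _ r‖ ≤ _
    have hb : ∀ r ∈ Ioc (0 : ℝ) s,
        ‖IccExtend zero_le_one (pointwiseApply _ E E A ((volterra A ^ n) y)) r‖ ≤
          ‖A‖ ^ (n + 1) * ‖y‖ / n.factorial * r ^ n := by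
      intro r hr
      have hr' : r ∈ Icc (0 : ℝ) 1 := ⟨hr.1.le, hr.2.trans s.2.2⟩
      rw [IccExtend_of_mem _ _ hr', pointwiseApply_apply]
      calc _ ≤ ‖A ⟨r, hr'⟩‖ * ‖(volterra A ^ n) y ⟨r, hr'⟩‖ := ContinuousLinearMap.le_opNorm _ _
        _ ≤ ‖A‖ * (‖A‖ ^ n * ‖y‖ * (r ^ n / n.factorial)) :=
          mul_le_mul (A.norm_coe_le_norm _) (ih ⟨r, hr'⟩) (norm_nonneg _) (norm_nonneg A)
        _ = _ := by ring
    have h := intervalIntegral.norm_integral_le_of_norm_le (μ := MeasureTheory.volume) s.2.1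
      (Eventually.of_forall hb) ((by fun_prop : Continuous fun r : ℝ =>
        ‖A‖ ^ (n + 1) * ‖y‖ / n.factorial * r ^ n).intervalIntegrable _ _)
    refine h.trans (le_of_eq ?_)
    rw [intervalIntegral.integral_const_mul, integral_pow, Nat.factorial_succ]
    push_cast
    field_simp
    simp

/-- Linear Volterra equations of the second kind are uniquely solvable. -/
theorem isUnit_one_sub_volterra (A : C(Icc (0 : ℝ) 1, E →L[ℝ] E)) [CompleteSpace E] :
    IsUnit (1 - volterra A) := by
  obtain ⟨n, hn⟩ := ((FloorSemiring.tendsto_pow_div_factorial_atTop ‖A‖).eventually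
    (gt_mem_nhds (zero_lt_one' ℝ))).exists
  have hlt : ‖volterra A ^ n‖ < 1 := by
    refine lt_of_le_of_lt (ContinuousLinearMap.opNorm_le_bound _ (by positivity) fun y => ?_) hn
    rw [ContinuousMap.norm_le _ (by positivity)]
    intro s
    refine (norm_volterra_pow_apply_le A y n s).trans ?_
    have : (s : ℝ) ^ n ≤ 1 := pow_le_one₀ s.2.1 s.2.2
    calc _ ≤ ‖A‖ ^ n * ‖y‖ * (1 / n.factorial) := by gcongr
      _ = _ := by ring
  have hu : IsUnit (1 - volterra A ^ n) := 
    isUnit_one_sub_of_norm_lt_one (R := C(Icc (0 : ℝ) 1, E) →L[ℝ] C(Icc (0 : ℝ) 1, E)) hlt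
  -- `1 - V ^ n` is the product of `1 - V` and the geometric sum; since these commute, invertibility
  -- of the product passes to each factor.
  have hc : Commute (1 - volterra A) (∑ i ∈ Finset.range n, volterra A ^ i) := by
    refine Commute.sum_right _ _ _ fun i _ => ?_
    exact (Commute.one_left _).sub_left ((Commute.refl _).pow_right i)
  rw [← mul_neg_geom_sum] at hu
  exact (hc.isUnit_mul_iff.1 hu).1

end Volterra

/-! ### Uniqueness for linear and autonomous equations. -/

section Uniqueness

variable {E : Type*} [NormedAddCommGroup E] [NormedSpace ℝ E]

theorem exists_mem_Ioo_pair (s t : ℝ) : ∃ a b, s ∈ Ioo a b ∧ t ∈ Ioo a b :=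
  ⟨min s t - 1, max s t + 1, by grind, by grind⟩

/-- A solution of a linear equation with continuous coefficients that vanishes once is zero. -/
theorem eq_zero_of_hasDerivAt_clm {A : ℝ → E →L[ℝ] E} (hA : Continuous A) {y : ℝ → E}
    (hy : ∀ t, HasDerivAt y (A t (y t)) t) {t₀ : ℝ} (h₀ : y t₀ = 0) (t : ℝ) : y t = 0 := by
  obtain ⟨a, b, ht, ht₀⟩ := exists_mem_Ioo_pair t t₀
  obtain ⟨C, hC⟩ := (isCompact_Icc (a := a) (b := b)).exists_bound_of_continuousOn hA.continuousOn
  refine ODE_solution_unique_of_mem_Ioo (v := fun t x => A t x) (s := fun _ => univ)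
    (K := C.toNNReal) (fun r hr => ?_) ht₀ (fun r _ => ⟨hy r, mem_univ _⟩)
    (g := fun _ => 0) (fun r _ => ⟨by simpa using hasDerivAt_const r (0 : E), mem_univ _⟩) h₀ ht
  refine ((A r).lipschitz.weaken ?_).lipschitzOnWith
  rw [← NNReal.coe_le_coe, coe_nnnorm]
  exact (hC r (Ioo_subset_Icc_self hr)).trans (Real.le_coe_toNNReal C)

/-- Global uniqueness for autonomous equations with `C¹` right-hand side. -/
theorem eq_of_hasDerivAt_autonomous {f : E → E} (hf : ContDiff ℝ 1 f) {x y : ℝ → E}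
    (hx : ∀ t, HasDerivAt x (f (x t)) t) (hy : ∀ t, HasDerivAt y (f (y t)) t) {t₀ : ℝ}
    (h₀ : x t₀ = y t₀) (t : ℝ) : x t = y t := by
  obtain ⟨a, b, ht, ht₀⟩ := exists_mem_Ioo_pair t t₀
  have hxc : Continuous x := continuous_iff_continuousAt.2 fun t => (hx t).continuousAt
  have hyc : Continuous y := continuous_iff_continuousAt.2 fun t => (hy t).continuousAt
  -- A Lipschitz constant is needed only on the compact union of the two arcs.
  obtain ⟨K, hK⟩ := hf.locallyLipschitz.locallyLipschitzOn.exists_lipschitzOnWith_of_compact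
    ((isCompact_Icc.image hxc).union ((isCompact_Icc (a := a) (b := b)).image hyc))
  exact ODE_solution_unique_of_mem_Ioo (v := fun _ => f) (s := fun _ => _)
    (fun _ _ => hK) ht₀
    (fun r hr => ⟨hx r, .inl (mem_image_of_mem x (Ioo_subset_Icc_self hr))⟩)
    (fun r hr => ⟨hy r, .inr (mem_image_of_mem y (Ioo_subset_Icc_self hr))⟩) h₀ ht

end Uniqueness

/-! ### Simple multipliers and transversality of the period map. -/

section Multiplier

open Matrix

/-- A `2 × 2` matrix that fixes `p` and shears `y` along `p` has `1` as a double eigenvalue. -/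
theorem rootMultiplicity_charpoly_of_shear {M : Matrix (Fin 2) (Fin 2) ℝ} {p y : Fin 2 → ℝ} {k : ℝ}
    (hp : M *ᵥ p = p) (hy : M *ᵥ y = y + k • p)
    (hli : ∀ s t : ℝ, s • p + t • y = 0 → s = 0 ∧ t = 0) :
    M.charpoly.rootMultiplicity 1 = 2 := by
  have hP : IsUnit (Matrix.of ![p, y])ᵀ := by
    rw [← Matrix.linearIndependent_cols_iff_isUnit]
    exact LinearIndependent.pair_iff.2 hli
  obtain ⟨P, hP⟩ := hP
  have hMP : M * P.val = P.val * !![1, k; 0, 1] := by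
    rw [hP]
    have hp0 := congrFun hp 0
    have hp1 := congrFun hp 1
    have hy0 := congrFun hy 0
    have hy1 := congrFun hy 1
    simp [Matrix.mulVec, dotProduct, Fin.sum_univ_two] at hp0 hp1 hy0 hy1
    ext i j
    fin_cases i <;> fin_cases j <;> simp [Matrix.mul_apply, Fin.sum_univ_two] <;> linarith
  have hM : M = P.val * !![1, k; 0, 1] * P⁻¹.val := by
    rw [← hMP, mul_assoc, Units.mul_inv, mul_one]
  have hc : (!![1, k; 0, 1] : Matrix (Fin 2) (Fin 2) ℝ).charpoly =
      (Polynomial.X - Polynomial.C 1) ^ 2 := by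
    simp [Matrix.charpoly, Matrix.det_fin_two]
    ring
  rw [hM, Matrix.coe_units_inv, Matrix.charpoly_units_conj, hc,
    Polynomial.rootMultiplicity_X_sub_C_pow]

theorem hasDerivAt_mulVec_of_isFundamentalMatrix
    {A : ℝ → (Fin 2 → ℝ) →L[ℝ] (Fin 2 → ℝ)} {Φ : ℝ → Matrix (Fin 2) (Fin 2) ℝ}
    (hΦ : IsFundamentalMatrix (fun t => LinearMap.toMatrix' (A t : (Fin 2 → ℝ) →ₗ[ℝ] _)) Φ)
    (v : Fin 2 → ℝ) (t : ℝ) : HasDerivAt (fun s => Φ s *ᵥ v) (A t (Φ t *ᵥ v)) t := by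
  have hA : A t (Φ t *ᵥ v) = (LinearMap.toMatrix' (A t : (Fin 2 → ℝ) →ₗ[ℝ] _) * Φ t) *ᵥ v := by
    rw [← Matrix.mulVec_mulVec, LinearMap.toMatrix'_mulVec]
    rfl
  rw [hA, hasDerivAt_pi]
  intro i
  exact HasDerivAt.fun_sum (u := Finset.univ) fun j _ => (hΦ.2 t i j).mul_const (v j)

/-- For a periodic linear plane system with periodic solution `p` and simple multiplier `1`, the
period map moves every solution independent of `p` transversally to `p`. -/
theorem exists_transversal_solution {A : ℝ → (Fin 2 → ℝ) →L[ℝ] (Fin 2 → ℝ)} (hA : Continuous A)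
    {T : ℝ} (hAT : Function.Periodic A T) {p : ℝ → Fin 2 → ℝ}
    (hp : ∀ t, HasDerivAt p (A t (p t)) t) (hpT : Function.Periodic p T) {t₀ : ℝ} {v : Fin 2 → ℝ}
    (hli : ∀ s t : ℝ, s • p t₀ + t • v = 0 → s = 0 ∧ t = 0)
    (hsimple : IsSimpleMultiplier
      (fun t => LinearMap.toMatrix' (A t : (Fin 2 → ℝ) →ₗ[ℝ] (Fin 2 → ℝ))) T 1) :
    ∃ y : ℝ → Fin 2 → ℝ, (∀ t, HasDerivAt y (A t (y t)) t) ∧ y t₀ = v ∧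
      ∀ s t : ℝ, s • p t₀ + t • (y (t₀ + T) - v) = 0 → s = 0 ∧ t = 0 := by
  obtain ⟨Φ, hΦ, hmult⟩ := hsimple
  have hsol := hasDerivAt_mulVec_of_isFundamentalMatrix hΦ
  have hΦ₀ : ∀ v, Φ 0 *ᵥ v = v := fun v => by rw [hΦ.1, Matrix.one_mulVec]
  -- `Φ` is normalized at `0` while `v` is prescribed at `t₀`, so `Φ t₀` has to be inverted.
  have hinj : Function.Injective (Matrix.mulVecLin (Φ t₀)) := by
    rw [← LinearMap.ker_eq_bot, LinearMap.ker_eq_bot']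
    intro w hw
    rw [← hΦ₀ w]
    exact eq_zero_of_hasDerivAt_clm hA (hsol w) hw 0
  obtain ⟨w, hw⟩ := LinearMap.injective_iff_surjective.1 hinj v
  change Φ t₀ *ᵥ w = v at hw
  refine ⟨fun t => Φ t *ᵥ w, hsol w, hw, fun s k hsk => ?_⟩
  have hk : k = 0 := by
    by_contra hk
    have hpΦ : ∀ t, p t = Φ t *ᵥ p 0 := fun t => by
      rw [← sub_eq_zero]
      refine eq_zero_of_hasDerivAt_clm (y := fun t => p t - Φ t *ᵥ p 0) (t₀ := 0) hA (fun t => ?_)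
        (by simp [hΦ₀]) t
      simp only [map_sub]
      exact (hp t).sub (hsol (p 0) t)
    have hshift : ∀ t, HasDerivAt (fun t => Φ (t + T) *ᵥ w) (A t (Φ (t + T) *ᵥ w)) t := fun t => by
      rw [← hAT t]
      exact (hsol w (t + T)).comp_add_const t T
    -- The dependence relation at `t₀` is the value of a solution, so it can be carried to time `0`,
    -- where `Φ T` is the period map.
    have hz := eq_zero_of_hasDerivAt_clm
      (y := fun t => s • p t + k • (Φ (t + T) *ᵥ w - Φ t *ᵥ w)) (t₀ := t₀) hA (fun t => by
        simp only [map_add, map_sub, map_smul]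
        exact ((hp t).const_smul s).add (((hshift t).sub (hsol w t)).const_smul k))
      (by simpa [hw] using hsk) 0
    have hli₀ : ∀ a b : ℝ, a • p 0 + b • w = 0 → a = 0 ∧ b = 0 := fun a b hab => by
      refine hli a b ?_
      have := eq_zero_of_hasDerivAt_clm (y := fun t => a • p t + b • (Φ t *ᵥ w)) (t₀ := 0) hA
        (fun t => by
          simp only [map_add, map_smul]
          exact ((hp t).const_smul a).add ((hsol w t).const_smul b))
        (by simpa [hΦ₀] using hab) t₀
      rwa [hw] at this
    have h2 : (Φ T).charpoly.rootMultiplicity 1 = 2 := by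
      -- The shear coefficient comes from solving `s p(0) + k (Φ(T) w - w) = 0` for `Φ(T) w`.
      refine rootMultiplicity_charpoly_of_shear (p := p 0) (y := w) (k := -(s / k)) ?_ ?_ hli₀
      · rw [← hpΦ, ← zero_add T, hpT]
      · simp only [zero_add, hΦ₀] at hz
        have : k • (Φ T *ᵥ w) = k • (w + -(s / k) • p 0) := by
          rw [smul_add, smul_smul, mul_neg, mul_div_cancel₀ _ hk]
          rw [← sub_eq_zero, ← hz]
          module
        exact smul_right_injective _ hk this
    omega
  subst hk
  exact ⟨(hli s 0 (by simpa using hsk)).1, rfl⟩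

end Multiplier

/-! ### The unperturbed Liénard equation. -/

section Lienard

variable {φ : ℝ × ℝ → ℝ} {ψ : ℝ → ℝ}

theorem contDiff_lienardField (hφ : ContDiff ℝ 1 φ) (hψ : ContDiff ℝ 1 ψ) :
    ContDiff ℝ 1 (lienardField φ ψ) := by
  rw [contDiff_pi]
  intro i
  fin_cases i
  · simp only [lienardField, Fin.zero_eta, Matrix.cons_val_zero]
    fun_prop
  · change ContDiff ℝ 1 fun x : Fin 2 → ℝ => x 0
    fun_prop

theorem IsLienardSolution.hasDerivAt {u : ℝ → ℝ}
    (hu : IsLienardSolution φ ψ (fun _ _ _ => 0) u) (t : ℝ) :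
    HasDerivAt (fun t => ![deriv u t, u t]) (lienardField φ ψ ![deriv u t, u t]) t := by
  rw [hasDerivAt_pi]
  intro i
  fin_cases i
  · have h : lienardField φ ψ ![deriv u t, u t] 0 = deriv (deriv u) t := by
      have := hu.2.2 t
      simp [lienardField]
      linarith
    simpa [h] using (hu.2.1 t).hasDerivAt
  · simpa [lienardField] using (hu.1 t).hasDerivAt

/-- A nonconstant periodic solution of the Liénard equation has a negative minimum. -/
theorem IsLienardSolution.exists_neg_deriv_eq_zero {u : ℝ → ℝ} {T : ℝ} (hφ : ContDiff ℝ 1 φ)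
    (hψ : ContDiff ℝ 1 ψ) (hsign : ∀ x : ℝ, 0 < |x| → 0 < x * ψ x)
    (hu : IsLienardSolution φ ψ (fun _ _ _ => 0) u) (hconst : ¬ ∃ c : ℝ, ∀ t : ℝ, u t = c)
    (hT : 0 < T) (hper : Function.Periodic u T) : ∃ t₀ : ℝ, u t₀ < 0 ∧ deriv u t₀ = 0 := by
  obtain ⟨t₀, -, ht₀⟩ := isCompact_Icc.exists_isMinOn (nonempty_Icc.2 hT.le)
    hu.1.continuous.continuousOn
  have hmin : ∀ t, u t₀ ≤ u t := fun t => by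
    obtain ⟨s, hs, hst⟩ := hper.exists_mem_Ico₀ hT t
    rw [hst]
    exact ht₀ (Ico_subset_Icc_self hs)
  have hd : deriv u t₀ = 0 := IsLocalMin.deriv_eq_zero (Eventually.of_forall hmin)
  refine ⟨t₀, ?_, hd⟩
  by_contra! hge
  have hdd : deriv (deriv u) t₀ = -ψ (u t₀) := by
    have := hu.2.2 t₀
    rw [hd] at this
    linarith
  -- A minimum equal to `0` would put the orbit at the equilibrium. A positive one would give `u'' <
  -- 0` there, making it also a local maximum, so that `u` is locally constant and `u'' = 0`.
  rcases hge.eq_or_lt with h0 | hpos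
  · have hψ0 : ψ 0 = 0 := by
      have hneg : ∀ᶠ x in 𝓝[<] (0 : ℝ), ψ x ≤ 0 := by
        filter_upwards [self_mem_nhdsWithin] with x hx
        have h := hsign x (abs_pos.2 (ne_of_lt hx))
        have hx : x < 0 := hx
        nlinarith
      have hpos : ∀ᶠ x in 𝓝[>] (0 : ℝ), 0 ≤ ψ x := by
        filter_upwards [self_mem_nhdsWithin] with x hx
        have h := hsign x (abs_pos.2 (ne_of_gt hx))
        have hx : 0 < x := hx
        nlinarith
      have hc := hψ.continuous.tendsto 0
      exact le_antisymm (le_of_tendsto (hc.mono_left nhdsWithin_le_nhds) hneg)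
        (ge_of_tendsto (hc.mono_left nhdsWithin_le_nhds) hpos)
    refine hconst ⟨0, fun t => ?_⟩
    have := eq_of_hasDerivAt_autonomous (contDiff_lienardField hφ hψ) hu.hasDerivAt
      (y := fun _ => 0) (t₀ := t₀) (fun t => by
        have : lienardField φ ψ 0 = 0 := by
          ext i; fin_cases i <;> simp [lienardField, hψ0]
        rw [this]
        exact hasDerivAt_const t 0) (by ext i; fin_cases i <;> simp [hd, ← h0]) t
    simpa using congrFun this 1
  · have hψpos : 0 < ψ (u t₀) := pos_of_mul_pos_right (hsign _ (abs_pos.2 hpos.ne')) hpos.le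
    have hmax : IsLocalMax u t₀ := isLocalMax_of_deriv_deriv_neg (by rw [hdd]; linarith) hd
      hu.1.continuous.continuousAt
    have hev : u =ᶠ[𝓝 t₀] fun _ => u t₀ := hmax.mono fun t ht => le_antisymm ht (hmin t)
    have : deriv (deriv u) t₀ = 0 := by
      rw [hev.deriv.deriv_eq]
      simp
    linarith

end Lienard

/-! ### From the integral equation on `[0, 1]` to periodic solutions on the line. -/

section PeriodicExtension

variable {E : Type*} [NormedAddCommGroup E] [NormedSpace ℝ E] [CompleteSpace E]

/-- A solution of the integral equation on `[0, 1]` with equal end values extends to a periodic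
solution of the differential equation. -/
theorem exists_periodic_hasDerivAt_of_primitive_eq {v : ℝ → E → E}
    (hv : Continuous fun z : ℝ × E => v z.1 z.2) (hper : ∀ s x, v (s + 1) x = v s x)
    {x n : C(Icc (0 : ℝ) 1, E)} (hn : ∀ s : Icc (0 : ℝ) 1, n s = v s (x s)) (h01 : x 1 = x 0)
    (hx : ∀ s, x s = x 0 + primitiveCLM E n s) :
    ∃ X : ℝ → E, Function.Periodic X 1 ∧ X 0 = x 0 ∧ ∀ s, HasDerivAt X (v s (X s)) s := by
  let X : ℝ → E := IccExtend zero_le_one x ∘ Int.fract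
  have hXper : Function.Periodic X 1 := fun s => by simp [X]
  have hXI : ∀ s : Icc (0 : ℝ) 1, X s = x s := fun s => by
    rcases s.2.2.eq_or_lt with h | h
    · have hs : s = 1 := Subtype.ext h
      subst hs
      simp only [X, Function.comp_apply, Icc.coe_one, Int.fract_one, h01]
      exact IccExtend_left _ _
    · simp only [X, Function.comp_apply, Int.fract_eq_self.2 ⟨s.2.1, h⟩]
      exact IccExtend_val _ _ s
  have hXc : Continuous X := by
    refine ContinuousOn.comp_fract'' (x.continuous.Icc_extend' (h := zero_le_one)).continuousOn ?_
    rw [IccExtend_left, IccExtend_right]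
    exact h01.symm
  have hmc : Continuous fun s => v s (X s) := hv.comp (continuous_id.prodMk hXc)
  have hmper : Function.Periodic (fun s => v s (X s)) 1 := fun s => by
    change v (s + 1) (X (s + 1)) = _
    rw [hper, hXper]
  let Y : ℝ → E := fun s => x 0 + ∫ r in (0 : ℝ)..s, v r (X r)
  have hYI : ∀ s : Icc (0 : ℝ) 1, Y s = x s := fun s => by
    rw [hx s, primitiveCLM_apply]
    refine congrArg (x 0 + ·) (intervalIntegral.integral_congr fun r hr => ?_)
    rw [uIcc_of_le s.2.1] at hr
    have hr' : r ∈ Icc (0 : ℝ) 1 := ⟨hr.1, hr.2.trans s.2.2⟩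
    change v r (X r) = _
    rw [IccExtend_of_mem _ _ hr', hn, ← hXI ⟨r, hr'⟩]
  -- Equal end values mean that the integral over a period vanishes. Identifying `X` with the
  -- primitive `Y` then gives differentiability at the integers too.
  have hYper : Function.Periodic Y 1 := fun s => by
    have h1 : ∫ r in (0 : ℝ)..(0 + 1), v r (X r) = 0 := by
      have := hYI 1
      rw [h01] at this
      simpa [Y] using this
    simp only [Y]
    rw [hmper.intervalIntegral_add_eq_add 0 s (fun _ _ => hmc.intervalIntegrable _ _), h1, add_zero]
  have hXY : X = Y := by
    ext s
    have hs : Int.fract s ∈ Icc (0 : ℝ) 1 := ⟨Int.fract_nonneg s, (Int.fract_lt_one s).le⟩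
    have hX := hXper.sub_int_mul_eq (x := s) ⌊s⌋
    have hY := hYper.sub_int_mul_eq (x := s) ⌊s⌋
    rw [mul_one] at hX hY
    rw [← hX, ← hY]
    exact (hXI ⟨_, hs⟩).trans (hYI ⟨_, hs⟩).symm
  refine ⟨X, hXper, hXI 0, fun s => ?_⟩
  have := ((hmc.integral_hasStrictDerivAt 0 s).hasDerivAt).const_add (x 0)
  rwa [show (fun s => x 0 + ∫ r in (0 : ℝ)..s, v r (X r)) = X from hXY.symm] at this

end PeriodicExtension

/-! ### The periodicity problem as a `C¹` equation, and its solution by implicit functions. -/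

section PeriodicFamily

variable {E : Type*} [NormedAddCommGroup E] [NormedSpace ℝ E]

/-- Constant functions, as a continuous linear map. -/
def constCLM (K E : Type*) [TopologicalSpace K] [CompactSpace K] [NormedAddCommGroup E]
    [NormedSpace ℝ E] : E →L[ℝ] C(K, E) where
  toFun := ContinuousMap.const K
  map_add' _ _ := rfl
  map_smul' _ _ := rfl
  cont := ContinuousMap.continuous_const'

@[simp]
theorem constCLM_apply {K : Type*} [TopologicalSpace K] [CompactSpace K] (v : E) (s : K) :
    constCLM K E v s = v := rfl

/-- The linearized periodicity problem in the period, the initial value along `e`, and the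
trajectory. -/
noncomputable def linearizedDefect (V : C(Icc (0 : ℝ) 1, E) →L[ℝ] C(Icc (0 : ℝ) 1, E))
    (r : C(Icc (0 : ℝ) 1, E)) (e : E) :
    ℝ × ℝ × C(Icc (0 : ℝ) 1, E) →L[ℝ] C(Icc (0 : ℝ) 1, E) × E :=
  let τ := ContinuousLinearMap.fst ℝ ℝ (ℝ × C(Icc (0 : ℝ) 1, E))
  let h := ContinuousLinearMap.fst ℝ ℝ C(Icc (0 : ℝ) 1, E) ∘L ContinuousLinearMap.snd ℝ ℝ _
  let y := ContinuousLinearMap.snd ℝ ℝ C(Icc (0 : ℝ) 1, E) ∘L ContinuousLinearMap.snd ℝ ℝ _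
  ((1 - V) ∘L y - h.smulRight (constCLM _ E e) - τ.smulRight r).prod
    (ContinuousMap.evalCLM ℝ 1 ∘L y - h.smulRight e)

theorem linearizedDefect_apply (V : C(Icc (0 : ℝ) 1, E) →L[ℝ] C(Icc (0 : ℝ) 1, E))
    (r : C(Icc (0 : ℝ) 1, E)) (e : E) (τ h : ℝ) (y : C(Icc (0 : ℝ) 1, E)) :
    linearizedDefect V r e (τ, h, y) =
      ((1 - V) y - h • constCLM _ E e - τ • r, y 1 - h • e) := rfl

/-- Solving the first component for the trajectory gives `x = (1 - V)⁻¹ g + τ w + h y`; the second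
component then becomes the finite-dimensional equation governed by `hbij`. -/
theorem isInvertible_linearizedDefect [CompleteSpace E]
    {V : C(Icc (0 : ℝ) 1, E) →L[ℝ] C(Icc (0 : ℝ) 1, E)} (hV : IsUnit (1 - V))
    {r y w : C(Icc (0 : ℝ) 1, E)} {e : E} (hy : (1 - V) y = constCLM _ E e) (hw : (1 - V) w = r)
    (hbij : Function.Bijective fun z : ℝ × ℝ => z.1 • w 1 + z.2 • (y 1 - e)) :
    (linearizedDefect V r e).IsInvertible := by
  obtain ⟨S, hSl, hSr⟩ : ∃ S : C(Icc (0 : ℝ) 1, E) →L[ℝ] C(Icc (0 : ℝ) 1, E),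
      (∀ x, S ((1 - V) x) = x) ∧ ∀ x, (1 - V) (S x) = x := by
    obtain ⟨U, hU⟩ := hV
    rw [← hU]
    exact ⟨U⁻¹.val, fun x => congrArg (· x) U.inv_mul, fun x => congrArg (· x) U.mul_inv⟩
  have hb : Function.Bijective (linearizedDefect V r e) := by
    constructor
    · refine (injective_iff_map_eq_zero _).2 fun ⟨τ, h, x⟩ hz => ?_
      rw [linearizedDefect_apply, Prod.mk_eq_zero] at hz
      have hx : x = τ • w + h • y := by
        rw [← hSl x, ← hSl (τ • w + h • y), map_add, map_smul, map_smul, hy, hw]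
        congr 1
        rw [← sub_eq_zero, ← hz.1]
        abel
      have h0 : (τ, h) = ((0, 0) : ℝ × ℝ) := hbij.1 (by
        have h2 := hz.2
        rw [hx] at h2
        simp only [ContinuousMap.add_apply, ContinuousMap.smul_apply] at h2
        simp only [zero_smul, smul_sub, ← h2]
        abel)
      obtain ⟨rfl, rfl⟩ := Prod.mk.inj h0
      simp [hx]
    · rintro ⟨g, c⟩
      obtain ⟨⟨τ, h⟩, hz⟩ := hbij.2 (c - S g 1)
      refine ⟨(τ, h, S g + τ • w + h • y), ?_⟩
      rw [linearizedDefect_apply, map_add, map_add, map_smul, map_smul, hy, hw, hSr]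
      refine Prod.ext (by simp only; abel) ?_
      rw [eq_sub_iff_add_eq] at hz
      simp only [ContinuousMap.add_apply, ContinuousMap.smul_apply, ← hz, smul_sub]
      abel
  -- Continuity of the inverse is the open mapping theorem.
  exact ⟨ContinuousLinearEquiv.ofBijective _ (LinearMap.ker_eq_bot.2 hb.1)
    (LinearMap.range_eq_top.2 hb.2), rfl⟩

/-- The curve `s ↦ (ε, s + α / τ, x s)`. -/
noncomputable def phaseCurve (z : (ℝ × ℝ) × (ℝ × ℝ × C(Icc (0 : ℝ) 1, E))) :
    C(Icc (0 : ℝ) 1, ℝ × ℝ × E) :=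
  constCLM _ (ℝ × ℝ × E) (z.1.1, z.1.2 / z.2.1, 0) +
    ⟨fun s : Icc (0 : ℝ) 1 => ((0, (s : ℝ), 0) : ℝ × ℝ × E), by fun_prop⟩ +
    (ContinuousLinearMap.inr ℝ ℝ (ℝ × E) ∘L ContinuousLinearMap.inr ℝ ℝ E).compLeftContinuous ℝ
      (Icc (0 : ℝ) 1) z.2.2.2

@[simp]
theorem phaseCurve_apply (z : (ℝ × ℝ) × (ℝ × ℝ × C(Icc (0 : ℝ) 1, E))) (s : Icc (0 : ℝ) 1) :
    phaseCurve z s = (z.1.1, s + z.1.2 / z.2.1, z.2.2.2 s) := by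
  simp [phaseCurve, add_comm]

theorem contDiffAt_phaseCurve {z : (ℝ × ℝ) × (ℝ × ℝ × C(Icc (0 : ℝ) 1, E))} (hz : z.2.1 ≠ 0) :
    ContDiffAt ℝ 1 (phaseCurve (E := E)) z := by
  have h : ∀ (L : C(Icc (0 : ℝ) 1, E) →L[ℝ] C(Icc (0 : ℝ) 1, ℝ × ℝ × E)) b, ContDiffAt ℝ 1
      (fun z : (ℝ × ℝ) × (ℝ × ℝ × C(Icc (0 : ℝ) 1, E)) =>
        constCLM _ (ℝ × ℝ × E) (z.1.1, z.1.2 / z.2.1, 0) + b + L z.2.2.2) z := by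
    fun_prop (disch := assumption)
  exact h _ _

/-- The failure of `x` to be a `1`-periodic solution, with `x(0) = c + h e`, of
`x' = τ g(ε, s + α / τ, x)`. -/
noncomputable def periodicDefect (g : C(ℝ × ℝ × E, E)) (c e : E)
    (z : (ℝ × ℝ) × (ℝ × ℝ × C(Icc (0 : ℝ) 1, E))) : C(Icc (0 : ℝ) 1, E) × E :=
  (z.2.2.2 - constCLM _ E (c + z.2.2.1 • e) - primitiveCLM E (z.2.1 • g.comp (phaseCurve z)),
    ContinuousMap.evalCLM ℝ 1 z.2.2.2 - (c + z.2.2.1 • e))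

theorem contDiffAt_periodicDefect {g : C(ℝ × ℝ × E, E)} (hg : ContDiff ℝ 1 g) (c e : E)
    {z : (ℝ × ℝ) × (ℝ × ℝ × C(Icc (0 : ℝ) 1, E))} (hz : z.2.1 ≠ 0) :
    ContDiffAt ℝ 1 (periodicDefect g c e) z := by
  have hN : ContDiffAt ℝ 1 (fun z => g.comp (phaseCurve (E := E) z)) z :=
    (contDiff_comp_left hg).contDiffAt.comp z (contDiffAt_phaseCurve hz)
  unfold periodicDefect
  fun_prop

/-- At `ε = 0` the field ignores the phase, so only the product `τ • f ∘ x` has to be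
differentiated: its `x`-part gives the Volterra operator, its `τ`-part the primitive of `f ∘ x`. -/
theorem hasFDerivAt_periodicDefect_zero {g : C(ℝ × ℝ × E, E)} {f : C(E, E)}
    {f' : C(E, E →L[ℝ] E)} (hf : ∀ x, HasFDerivAt f (f' x) x) (hgf : ∀ s x, g (0, s, x) = f x)
    (c e : E) (z : ℝ × ℝ × C(Icc (0 : ℝ) 1, E)) :
    HasFDerivAt (fun z => periodicDefect g c e (0, z))
      (linearizedDefect (volterra (z.1 • f'.comp z.2.2)) (primitiveCLM E (f.comp z.2.2)) e) z := by
  have heq : (fun z => periodicDefect g c e (0, z)) = fun z : ℝ × ℝ × C(Icc (0 : ℝ) 1, E) =>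
      (z.2.2 - constCLM _ E (c + z.2.1 • e) - primitiveCLM E (z.1 • f.comp z.2.2),
        ContinuousMap.evalCLM ℝ 1 z.2.2 - (c + z.2.1 • e)) := by
    ext z s
    · have : g.comp (phaseCurve (0, z)) = f.comp z.2.2 := by ext s; simp [hgf]
      simp only [periodicDefect, this]
    · rfl
  rw [heq]
  have hτ := (ContinuousLinearMap.fst ℝ ℝ (ℝ × C(Icc (0 : ℝ) 1, E))).hasFDerivAt (x := z)
  have hh := (ContinuousLinearMap.fst ℝ ℝ C(Icc (0 : ℝ) 1, E) ∘L
    ContinuousLinearMap.snd ℝ ℝ (ℝ × C(Icc (0 : ℝ) 1, E))).hasFDerivAt (x := z)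
  have hx := (ContinuousLinearMap.snd ℝ ℝ C(Icc (0 : ℝ) 1, E) ∘L
    ContinuousLinearMap.snd ℝ ℝ (ℝ × C(Icc (0 : ℝ) 1, E))).hasFDerivAt (x := z)
  have hN := (hasFDerivAt_comp_left hf z.2.2).comp z hx
  have hc := (hh.smul_const e).const_add c
  refine (((hx.sub ((constCLM (Icc (0 : ℝ) 1) E).hasFDerivAt.comp z hc)).sub
    ((primitiveCLM E).hasFDerivAt.comp z (hτ.smul hN))).prodMk
    (((ContinuousMap.evalCLM ℝ (1 : Icc (0 : ℝ) 1)).hasFDerivAt.comp z hx).sub hc)).congr_fderiv ?_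
  refine ContinuousLinearMap.ext fun ⟨τ, h, y⟩ => ?_
  rw [linearizedDefect_apply]
  refine Prod.ext ?_ rfl
  simp [volterra]
  abel

/-- Persistence of a nondegenerate periodic orbit of an autonomous equation under periodic
perturbations, in integral form on the rescaled period interval. -/
theorem exists_contDiffAt_periodicDefect_eq_zero [CompleteSpace E] {g : C(ℝ × ℝ × E, E)}
    (hg : ContDiff ℝ 1 g) {f : E → E} (hf : ContDiff ℝ 1 f) (hgf : ∀ s x, g (0, s, x) = f x)
    {T : ℝ} (hT : T ≠ 0) {q : ℝ → E} (hq : ∀ t, HasDerivAt q (f (q t)) t) (hqT : q T = q 0)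
    {e : E} {y : ℝ → E} (hy : ∀ t, HasDerivAt y (fderiv ℝ f (q t) (y t)) t) (hy₀ : y 0 = e)
    (hbij : Function.Bijective fun z : ℝ × ℝ => z.1 • f (q 0) + z.2 • (y T - e)) :
    ∃ Z : ℝ × ℝ → ℝ × ℝ × C(Icc (0 : ℝ) 1, E), ContDiffAt ℝ 1 Z 0 ∧ (Z 0).1 = T ∧ (Z 0).2.1 = 0 ∧
      ∀ᶠ p in 𝓝 0, periodicDefect g (q 0) e (p, Z p) = 0 := by
  let fC : C(E, E) := ⟨f, hf.continuous⟩
  let f' : C(E, E →L[ℝ] E) := ⟨fderiv ℝ f, hf.continuous_fderiv one_ne_zero⟩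
  have hf' : ∀ x, HasFDerivAt f (f' x) x := fun x =>
    (hf.differentiable one_ne_zero x).hasFDerivAt
  have hmul : ∀ s : ℝ, HasDerivAt (fun s => T * s) T s := fun s => by
    simpa using (hasDerivAt_id s).const_mul T
  have hqs : ∀ s, HasDerivAt (fun s => q (T * s)) (T • f (q (T * s))) s := fun s =>
    (hq (T * s)).scomp s (hmul s)
  have hys : ∀ s, HasDerivAt (fun s => y (T * s)) (T • f' (q (T * s)) (y (T * s))) s := fun s =>
    (hy (T * s)).scomp s (hmul s)
  have hfqs : ∀ s, HasDerivAt (fun s => f (q (T * s)))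
      (T • f' (q (T * s)) (f (q (T * s)))) s := fun s => by
    rw [← map_smul]
    exact (hf' (q (T * s))).comp_hasDerivAt s (hqs s)
  have hcont : ∀ {γ γ' : ℝ → E}, (∀ s, HasDerivAt γ (γ' s) s) → Continuous γ := fun h =>
    continuous_iff_continuousAt.2 fun s => (h s).continuousAt
  -- This curve is the derivative of `q (τ * s)` in `τ` at `τ = T`; it solves the linearized
  -- equation with source `f ∘ q` and ends at `f (q T) = f (q 0)`.
  have hws : ∀ s, HasDerivAt (fun s : ℝ => s • f (q (T * s)))
      (s • (T • f' (q (T * s)) (f (q (T * s)))) + (1 : ℝ) • f (q (T * s))) s := fun s =>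
    (hasDerivAt_id s).smul (hfqs s)
  let qC : C(Icc (0 : ℝ) 1, E) := ⟨fun s => q (T * s), (hcont hqs).comp continuous_subtype_val⟩
  let yC : C(Icc (0 : ℝ) 1, E) := ⟨fun s => y (T * s), (hcont hys).comp continuous_subtype_val⟩
  let wC : C(Icc (0 : ℝ) 1, E) := ⟨fun s => (s : ℝ) • f (q (T * s)),
    (hcont hws).comp continuous_subtype_val⟩
  let A : C(Icc (0 : ℝ) 1, E →L[ℝ] E) := T • f'.comp qC
  have hyV : (1 - volterra A) yC = constCLM _ E e := by
    ext s
    have : volterra A yC s = y (T * s) - y (T * 0) :=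
      primitiveCLM_eq_of_hasDerivAt (Y := fun s => y (T * s)) (fun s => hys s) s
    rw [mul_zero, hy₀] at this
    change y (T * s) - volterra A yC s = e
    rw [this, sub_sub_cancel]
  have hwV : (1 - volterra A) wC = primitiveCLM E (fC.comp qC) := by
    rw [sub_apply, sub_eq_iff_eq_add]
    change wC = primitiveCLM E _ + primitiveCLM E _
    rw [← map_add]
    ext s
    rw [primitiveCLM_eq_of_hasDerivAt (Y := fun s : ℝ => s • f (q (T * s))) fun s => by
      convert hws s using 1
      simp [A, fC, qC, wC]
      rw [add_comm, smul_comm]]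
    simp [wC]
  have hz₀ : periodicDefect g (q 0) e (0, (T, 0, qC)) = 0 := by
    have h1 : g.comp (phaseCurve (0, (T, 0, qC))) = fC.comp qC := by ext s; simp [hgf, fC]
    refine Prod.ext ?_ ?_
    · ext s
      have : primitiveCLM E (T • fC.comp qC) s = q (T * s) - q (T * 0) :=
        primitiveCLM_eq_of_hasDerivAt (Y := fun s => q (T * s)) (fun s => hqs s) s
      change q (T * s) - (q 0 + (0 : ℝ) • e) -
        primitiveCLM E (T • g.comp (phaseCurve (0, (T, 0, qC)))) s = 0
      rw [h1, this]
      simp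
    · simp [periodicDefect, qC, hqT]
  have cdf : ContDiffAt ℝ 1 (periodicDefect g (q 0) e) (0, (T, 0, qC)) :=
    contDiffAt_periodicDefect hg _ _ hT
  have hinv : (fderiv ℝ (periodicDefect g (q 0) e) (0, (T, 0, qC)) ∘L
      .inr ℝ (ℝ × ℝ) (ℝ × ℝ × C(Icc (0 : ℝ) 1, E))).IsInvertible := by
    have h1 := (cdf.differentiableAt one_ne_zero).hasFDerivAt.comp (T, 0, qC)
      (hasFDerivAt_prodMk_right (𝕜 := ℝ) (0 : ℝ × ℝ) (T, (0 : ℝ), qC))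
    rw [h1.unique (hasFDerivAt_periodicDefect_zero (f := fC) (f' := f') hf' hgf (q 0) e (T, 0, qC))]
    refine isInvertible_linearizedDefect (isUnit_one_sub_volterra A) hyV hwV ?_
    simpa [wC, yC, hqT] using hbij
  refine ⟨cdf.implicitFunction one_ne_zero hinv, cdf.contDiffAt_implicitFunction one_ne_zero hinv,
    ?_, ?_, ?_⟩
  · rw [cdf.implicitFunction_apply_self one_ne_zero hinv]
  · rw [cdf.implicitFunction_apply_self one_ne_zero hinv]
  · simpa only [hz₀] using cdf.eventually_apply_implicitFunction one_ne_zero hinv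

end PeriodicFamily

/-! ### The perturbed Liénard equation and its nondegeneracy at a turning point. -/

section PerturbedLienard

variable {φ : ℝ × ℝ → ℝ} {ψ : ℝ → ℝ} {ω : ℝ × ℝ × ℝ → ℝ}

/-- The vector field of the perturbed equation, as a function of `(ε, s, (u', u))`, where `s` is
time in units of the period. -/
def perturbedField (φ : ℝ × ℝ → ℝ) (ψ : ℝ → ℝ) (ω : ℝ × ℝ × ℝ → ℝ)
    (z : ℝ × ℝ × (Fin 2 → ℝ)) : Fin 2 → ℝ :=
  lienardField φ ψ z.2.2 + (z.1 * ω (z.2.1, z.2.2 1, z.2.2 0)) • ![1, 0]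

theorem contDiff_perturbedField (hφ : ContDiff ℝ 1 φ) (hψ : ContDiff ℝ 1 ψ) (hω : ContDiff ℝ 1 ω) :
    ContDiff ℝ 1 (perturbedField φ ψ ω) := by
  have := contDiff_lienardField hφ hψ
  unfold perturbedField
  fun_prop

/-- Periodic solutions of the plane system in rescaled time give periodic solutions of the perturbed
Liénard equation. -/
theorem isLienardSolution_of_rescaled {ε α τ : ℝ} (hτ : τ ≠ 0) {X : ℝ → Fin 2 → ℝ}
    (hX : ∀ s, HasDerivAt X (τ • perturbedField φ ψ ω (ε, s + α / τ, X s)) s) :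
    IsLienardSolution φ ψ (fun t x y => ε * ω (t / τ, x, y)) (fun t => X ((t - α) / τ) 1) ∧
      ∀ t, deriv (fun t => X ((t - α) / τ) 1) t = X ((t - α) / τ) 0 := by
  have hd : ∀ t, HasDerivAt (fun t => X ((t - α) / τ))
      (perturbedField φ ψ ω (ε, t / τ, X ((t - α) / τ))) t := fun t => by
    have h1 : HasDerivAt (fun t => (t - α) / τ) (1 / τ) t :=
      ((hasDerivAt_id t).sub_const α).div_const τ
    have h2 := (hX ((t - α) / τ)).scomp t h1
    rw [smul_smul, one_div_mul_cancel hτ, one_smul, ← add_div, sub_add_cancel] at h2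
    exact h2
  have h0 : ∀ t, HasDerivAt (fun t => X ((t - α) / τ) 0) _ t := fun t => hasDerivAt_pi.1 (hd t) 0
  have h1 : ∀ t, HasDerivAt (fun t => X ((t - α) / τ) 1) (X ((t - α) / τ) 0) t := fun t => by
    simpa [perturbedField, lienardField] using hasDerivAt_pi.1 (hd t) 1
  have hderiv : deriv (fun t => X ((t - α) / τ) 1) = fun t => X ((t - α) / τ) 0 :=
    funext fun t => (h1 t).deriv
  refine ⟨⟨fun t => (h1 t).differentiableAt, ?_, fun t => ?_⟩, fun t => congrFun hderiv t⟩
  · rw [hderiv]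
    exact fun t => (h0 t).differentiableAt
  · rw [hderiv, (h0 t).deriv]
    simp [perturbedField, lienardField]
    ring

/-- The period map of a Liénard cycle with simple multiplier `1` is nondegenerate at a turning
point: moving the period and the amplitude spans the plane. -/
theorem IsLienardSolution.bijective_period_amplitude {u : ℝ → ℝ} {T t₀ : ℝ} (hφ : ContDiff ℝ 1 φ)
    (hψ : ContDiff ℝ 1 ψ) (hu : IsLienardSolution φ ψ (fun _ _ _ => 0) u)
    (hper : Function.Periodic u T) (hsimple : IsSimpleMultiplier (variationalMatrix φ ψ u) T 1)
    (hd : deriv u t₀ = 0) (hψ₀ : ψ (u t₀) ≠ 0) :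
    ∃ y : ℝ → Fin 2 → ℝ,
      (∀ t, HasDerivAt y (fderiv ℝ (lienardField φ ψ) ![deriv u t, u t] (y t)) t) ∧
      y t₀ = ![0, 1] ∧
      Function.Bijective fun z : ℝ × ℝ =>
        z.1 • lienardField φ ψ ![deriv u t₀, u t₀] + z.2 • (y (t₀ + T) - ![0, 1]) := by
  have hf := contDiff_lienardField hφ hψ
  have hq := hu.hasDerivAt
  have hqc : Continuous fun t => ![deriv u t, u t] :=
    continuous_iff_continuousAt.2 fun t => (hq t).continuousAt
  have hqT : Function.Periodic (fun t => ![deriv u t, u t]) T := fun t => by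
    have h : deriv u (t + T) = deriv u t := by
      rw [← deriv_comp_add_const]
      congr 1
      exact funext hper
    simp only [h, hper t]
  obtain ⟨y, hy, hy₀, hli⟩ := exists_transversal_solution
    (A := fun t => fderiv ℝ (lienardField φ ψ) ![deriv u t, u t]) (t₀ := t₀) (v := ![0, 1])
    (p := fun t => lienardField φ ψ ![deriv u t, u t])
    ((hf.continuous_fderiv one_ne_zero).comp hqc)
    (fun t => congrArg (fderiv ℝ (lienardField φ ψ)) (hqT t))
    (fun t => ((hf.differentiable one_ne_zero _).hasFDerivAt.comp_hasDerivAt t (hq t)))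
    (fun t => congrArg (lienardField φ ψ) (hqT t))
    -- At the turning point the field is `(-ψ (u t₀), 0)`, independent of `(0, 1)`.
    (fun s t hst => by
      have h0 := congrFun hst 0
      have h1 := congrFun hst 1
      simp [lienardField, hd, hψ₀] at h0 h1
      exact ⟨h0, h1⟩) hsimple
  refine ⟨y, hy, hy₀, ?_⟩
  let L : ℝ × ℝ →ₗ[ℝ] (Fin 2 → ℝ) :=
    (LinearMap.fst ℝ ℝ ℝ).smulRight (lienardField φ ψ ![deriv u t₀, u t₀]) +
      (LinearMap.snd ℝ ℝ ℝ).smulRight (y (t₀ + T) - ![0, 1])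
  have hinj : Function.Injective L := (injective_iff_map_eq_zero L).2 fun z hz =>
    Prod.ext (hli z.1 z.2 hz).1 (hli z.1 z.2 hz).2
  exact ⟨hinj, (LinearMap.injective_iff_surjective_of_finrank_eq_finrank (by simp)).1 hinj⟩

end PerturbedLienard

theorem theorem1 (φ : ℝ × ℝ → ℝ) (ψ : ℝ → ℝ) (hφ : ContDiff ℝ 1 φ) (hψ : ContDiff ℝ 1 ψ)
    (hLS : LevinsonSmith φ ψ)
    (ω : ℝ × ℝ × ℝ → ℝ) (hω : ContDiff ℝ 1 ω)
    (hωper : ∀ s x y : ℝ, ω (s + 1, x, y) = ω (s, x, y))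
    (u₀ : ℝ → ℝ) (τ₀ : ℝ)
    (hu₀ : IsLienardSolution φ ψ (fun _ _ _ => 0) u₀)
    (hnonconst : ¬ ∃ c : ℝ, ∀ t : ℝ, u₀ t = c)
    (hτ₀ : IsLeast {T : ℝ | 0 < T ∧ Function.Periodic u₀ T} τ₀)
    (hsimple : IsSimpleMultiplier (variationalMatrix φ ψ u₀) τ₀ 1) :
    (∃ t₀ : ℝ, u₀ t₀ < 0 ∧ deriv u₀ t₀ = 0) ∧
    ∀ t₀ a : ℝ, u₀ t₀ = a → a < 0 → deriv u₀ t₀ = 0 →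
      ∃ (U : Set (ℝ × ℝ)) (τ h : ℝ × ℝ → ℝ) (τ₁ : ℝ),
        IsOpen U ∧ (0, 0) ∈ U ∧ 0 < τ₁ ∧ τ₁ < τ₀ ∧
        ContDiffOn ℝ 1 τ U ∧ ContDiffOn ℝ 1 h U ∧
        τ (0, 0) = τ₀ ∧ h (0, 0) = 0 ∧
        ∀ ε α : ℝ, (ε, α) ∈ U →
          |τ (ε, α) - τ₀| < τ₁ ∧
          ∃ u : ℝ → ℝ,
            IsLienardSolution φ ψ (fun t x y => ε * ω (t / τ (ε, α), x, y)) u ∧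
            u α = a + h (ε, α) ∧ deriv u α = 0 ∧
            Function.Periodic u (τ (ε, α)) := by
  obtain ⟨⟨hτpos, hper⟩, -⟩ := hτ₀
  refine ⟨hu₀.exists_neg_deriv_eq_zero hφ hψ hLS.sign hnonconst hτpos hper, ?_⟩
  rintro t₀ a rfl ha hd
  have hψ₀ : ψ (u₀ t₀) ≠ 0 := right_ne_zero_of_mul (hLS.sign _ (abs_pos.2 ha.ne)).ne'
  obtain ⟨y, hy, hy₀, hbij⟩ := hu₀.bijective_period_amplitude hφ hψ hper hsimple hd hψ₀
  have hg := contDiff_perturbedField hφ hψ hω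
  obtain ⟨Z, hZ, hZτ, hZh, hev⟩ := exists_contDiffAt_periodicDefect_eq_zero
    (g := ⟨perturbedField φ ψ ω, hg.continuous⟩) hg (contDiff_lienardField hφ hψ)
    (fun s x => by simp [perturbedField]) hτpos.ne'
    (q := fun t => ![deriv u₀ (t₀ + t), u₀ (t₀ + t)]) (y := fun t => y (t₀ + t)) (e := ![0, 1])
    (fun t => (hu₀.hasDerivAt (t₀ + t)).comp_const_add t₀ t)
    (by
      have h : deriv u₀ (t₀ + τ₀) = deriv u₀ t₀ := by
        rw [← deriv_comp_add_const]
        congr 1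
        exact funext hper
      simp [h, hper t₀])
    (fun t => (hy (t₀ + t)).comp_const_add t₀ t) (by simpa using hy₀) (by simpa using hbij)
  -- The bound `τ₁ = τ₀ / 2` also keeps the period away from `0`, as the rescaling requires.
  have hclose : ∀ᶠ p in 𝓝 (0 : ℝ × ℝ), |(Z p).1 - τ₀| < τ₀ / 2 := by
    have := hZ.continuousAt.fst.eventually (Metric.ball_mem_nhds (Z 0).1 (half_pos hτpos))
    simpa [Real.dist_eq, hZτ] using this
  obtain ⟨U, hU, hUo, h0U⟩ :=
    -- Being `C¹` at a point persists nearby, so one open `U` serves all three conditions.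
    eventually_nhds_iff.1 ((hZ.eventually (by simp)).and (hev.and hclose))
  refine ⟨U, fun p => (Z p).1, fun p => (Z p).2.1, τ₀ / 2, hUo, h0U, half_pos hτpos,
    half_lt_self hτpos, fun p hp => (hU p hp).1.fst.contDiffWithinAt,
    fun p hp => (hU p hp).1.snd.fst.contDiffWithinAt, hZτ, hZh, fun ε α hp => ?_⟩
  obtain ⟨-, hdef, hτ⟩ := hU _ hp
  refine ⟨hτ, ?_⟩
  have hτ' : (Z (ε, α)).1 ≠ 0 := by
    intro h
    rw [h, zero_sub, abs_neg, abs_of_pos hτpos] at hτ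
    linarith
  obtain ⟨hint, hend⟩ := Prod.mk_eq_zero.1 hdef
  set τ := (Z (ε, α)).1
  set b := (Z (ε, α)).2.1
  set x := (Z (ε, α)).2.2
  simp only [add_zero] at hint hend
  have hx : ∀ s, x s - (![deriv u₀ t₀, u₀ t₀] + b • ![0, 1]) - primitiveCLM _ _ s = 0 :=
    fun s => DFunLike.congr_fun hint s
  have hx0 : x 0 = ![deriv u₀ t₀, u₀ t₀] + b • ![0, 1] := by
    have h := hx 0
    rwa [primitiveCLM_apply_zero, sub_zero, sub_eq_zero] at h
  obtain ⟨X, hXper, hX0, hX⟩ := exists_periodic_hasDerivAt_of_primitive_eq (x := x)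
    (v := fun s x => τ • perturbedField φ ψ ω (ε, s + α / τ, x))
    (by have := hg.continuous; fun_prop)
    (fun s x => by simp only [perturbedField, add_right_comm s 1, hωper])
    (n := τ • ContinuousMap.comp ⟨_, hg.continuous⟩ (phaseCurve ((ε, α), Z (ε, α))))
    (fun s => by
      rw [ContinuousMap.smul_apply, ContinuousMap.comp_apply, phaseCurve_apply]
      rfl)
    ((sub_eq_zero.1 hend).trans hx0.symm)
    (fun s => by rw [hx0]; exact sub_eq_iff_eq_add'.1 (sub_eq_zero.1 (hx s)))
  obtain ⟨hsol, hderiv⟩ := isLienardSolution_of_rescaled hτ' hX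
  refine ⟨_, hsol, ?_, ?_, fun t => ?_⟩
  · simp [hX0, hx0, b]
  · rw [hderiv]
    simp [hX0, hx0, hd]
  · simp only
    rw [show (t + τ - α) / τ = (t - α) / τ + 1 by field_simp; ring, hXper]
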